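/- A \emph{bilateral birth--and--death process} with birth rates $\lambda_n$ and death rates $\mu_n$ ($n\in\mathbb Z$, all positive) is a time-homogeneous Markov process $X_t$, $t\ge 0$, on $\mathbb Z$ whose transition probabilities $p_{k,n}(t)=\Pr\{X_t=n\mid X_0=k\}$ are nonnegative, satisfy $\sum_n p_{k,n}(t)\le 1$ (a defect being the probability that the process has exploded before time $t$), $p_{k,n}(0)=\delta_{k,n}$ and the Chapman--Kolmogorov equations $p_{k,n}(s+t)=\sum_j p_{k,j}(s)\,p_{j,n}(t)$, and for which, as $\delta\downarrow 0$, $$\frac{p_{n,n+1}(\delta)}{\delta}\to\lambda_n,\qquad \frac{p_{n,n-1}(\delta)}{\delta}\to\mu_n,\qquad \frac{1-p_{n,n}(\delta)}{\delta}\to\lambda_n+\mu_n .$$ The process is \emph{simple} if its rates determine its transition probabilities uniquely. \textbf{Theorem.} Let $X_t$ be a simple bilateral birth--and--death process on $\mathbb Z$ with positive rates $\lambda_n,\mu_n$ and transition probabilities $p_{k,n}(t)$. Let $(\nu_n)_{n\in\mathbb Z}$ be a strictly monotonic (increasing or decreasing) sequence of positive numbers with $$\nu_{n+1}\lambda_n-\nu_n(\lambda_n+\mu_n)+\nu_{n-1}\mu_n=0\qquad(n\in\mathbb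 Z),$$ and put $$\widetilde\lambda_n=\lambda_n\frac{\nu_{n+1}}{\nu_n},\qquad \widetilde\mu_n=\mu_n\frac{\nu_{n-1}}{\nu_n}\qquad(n\in\mathbb Z).$$ Then the functions $\frac{\nu_n}{\nu_k}\,p_{k,n}(t)$ are the transition probabilities of a bilateral birth--and--death process with rates $\widetilde\lambda_n,\widetilde\mu_n$. Moreover, if $\widetilde X_t$ is a simple bilateral birth--and--death process with rates $\widetilde\lambda_n,\widetilde\mu_n$, then its transition probabilities are $$\widetilde p_{k,n}(t)=\frac{\nu_n}{\nu_k}\,p_{k,n}(t)\qquad(k,n\in\mathbb Z,\ t\ge 0).$$ -/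

import Mathlib

open Filter Topology

/-- `p t k n` (for `t ≥ 0`) are the transition probabilities `Pr{X_t = n | X_0 = k}` of a
time-homogeneous Markov process on `ℤ` which is a birth-and-death process with birth rates `lam n`
and death rates `mu n`.

As usual for Markov chains in continuous time, row sums are only required to be at most `1`: a
defect is the probability that the process has exploded (left `ℤ`) before time `t`. The last three
fields say that, as `δ ↓ 0`, the process moves from `n` to `n + 1` with probability
`lam n * δ + o(δ)`, to `n - 1` with probability `mu n * δ + o(δ)`, and that everything else apart
from staying at `n` has probability `o(δ)`. Values at negative times are irrelevant. -/
structure IsBirthDeathTransition (lam mu : ℤ → ℝ) (p : ℝ → ℤ → ℤ → ℝ) : Prop where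
  nonneg : ∀ t : ℝ, 0 ≤ t → ∀ k n : ℤ, 0 ≤ p t k n
  summable_row : ∀ t : ℝ, 0 ≤ t → ∀ k : ℤ, Summable fun n : ℤ => p t k n
  row_le_one : ∀ t : ℝ, 0 ≤ t → ∀ k : ℤ, ∑' n : ℤ, p t k n ≤ 1
  initial : ∀ k n : ℤ, p 0 k n = if n = k then 1 else 0
  chapman_kolmogorov : ∀ s t : ℝ, 0 ≤ s → 0 ≤ t → ∀ k n : ℤ,
    HasSum (fun j : ℤ => p s k j * p t j n) (p (s + t) k n)
  birth_rate : ∀ n : ℤ, Tendsto (fun δ : ℝ => p δ n (n + 1) / δ) (𝓝[>] 0) (𝓝 (lam n))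
  death_rate : ∀ n : ℤ, Tendsto (fun δ : ℝ => p δ n (n - 1) / δ) (𝓝[>] 0) (𝓝 (mu n))
  exit_rate : ∀ n : ℤ, Tendsto (fun δ : ℝ => (1 - p δ n n) / δ) (𝓝[>] 0) (𝓝 (lam n + mu n))

/-- The birth-and-death process with rates `lam`, `mu` is simple: the rates determine the
process, that is, its transition probabilities, uniquely. -/
def IsSimpleBirthDeath (lam mu : ℤ → ℝ) : Prop :=
  ∀ p q : ℝ → ℤ → ℤ → ℝ, IsBirthDeathTransition lam mu p → IsBirthDeathTransition lam mu q →
    ∀ t : ℝ, 0 ≤ t → ∀ k n : ℤ, p t k n = q t k n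

/-- Birth rates of the transformed process. -/
noncomputable def transformedBirth (lam nu : ℤ → ℝ) (n : ℤ) : ℝ := lam n * (nu (n + 1) / nu n)

/-- Death rates of the transformed process. -/
noncomputable def transformedDeath (mu nu : ℤ → ℝ) (n : ℤ) : ℝ := mu n * (nu (n - 1) / nu n)

/-! ### Exponentials of matrices with nonnegative off-diagonal entries -/

namespace Matrix

variable {ι κ : Type*} [Fintype ι] [DecidableEq ι] [Fintype κ] [DecidableEq κ]

/-! The transform is Doob's: weighting $p_{k,n}$ by $\nu_n/\nu_k$ preserves Chapman–Kolmogorov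
because the inner factors $\nu_j$ cancel, and harmonicity of $\nu$ leaves the total exit rate
unchanged. What needs proof is that the new rows sum to at most 1, that is, $\sum_n
p_{k,n}(t)\nu_n\le\nu_k$.

Simplicity reduces this to one concrete process with the given rates, the minimal one: the
increasing limit over finite $S$ of $\exp(tQ_S)$, where $Q_S$ is the generator cut down to $S$. For
$c$ large, $Q_S+cI$ has nonnegative entries, so $\exp(tQ_S)$ is a series in its powers with
nonnegative coefficients. If $w\ge 0$ and $Q_Sw\le 0$, then $(Q_S+cI)^m w\le c^m w$; summing the
series gives $\exp(tQ_S)w\le w$ (`Matrix.sum_exp_smul_apply_mul_le`), and the bound survives the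
limit in $S$. Taking $w=1$ bounds the rows of the minimal process, and $w=\nu$ gives the missing
inequality. Simplicity of the transformed rates then yields the second assertion. -/

theorem hasSum_exp_apply (A : Matrix ι ι ℝ) (i j : ι) :
    HasSum (fun m : ℕ => (m.factorial : ℝ)⁻¹ * (A ^ m) i j) (NormedSpace.exp A i j) := by
  have h : HasSum (fun m : ℕ => (m.factorial : ℝ)⁻¹ • A ^ m) (NormedSpace.exp A) := by
    open scoped Norms.Operator in exact NormedSpace.exp_series_hasSum_exp' (𝕂 := ℝ) A
  exact h.map (entryAddMonoidHom ℝ i j) (continuous_id.matrix_elem i j)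

/-- Expansion of the exponential of a matrix in powers of its shift by a multiple of the
identity. -/
theorem hasSum_exp_smul_apply (Q : Matrix ι ι ℝ) (c t : ℝ) (i j : ι) :
    HasSum (fun m : ℕ => Real.exp (-(t * c)) * ((m.factorial : ℝ)⁻¹ * t ^ m) *
      ((Q + c • (1 : Matrix ι ι ℝ)) ^ m) i j) (NormedSpace.exp (t • Q) i j) := by
  have hQ : t • Q = (-(t * c)) • (1 : Matrix ι ι ℝ) + t • (Q + c • (1 : Matrix ι ι ℝ)) := by
    rw [smul_add, smul_smul, neg_smul]; abel
  have hexp : NormedSpace.exp ((-(t * c)) • (1 : Matrix ι ι ℝ)) =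
      Real.exp (-(t * c)) • (1 : Matrix ι ι ℝ) := by
    rw [smul_one_eq_diagonal, exp_diagonal, smul_one_eq_diagonal, Real.exp_eq_exp_ℝ]
    congr 1
    ext x
    exact Pi.coe_exp _ x
  rw [hQ, exp_add_of_commute _ _ ((Commute.one_left _).smul_left _), hexp, smul_mul_assoc,
    one_mul, smul_apply, smul_eq_mul]
  refine ((hasSum_exp_apply (t • (Q + c • (1 : Matrix ι ι ℝ))) i j).mul_left
    (Real.exp (-(t * c)))).congr_fun fun m => ?_
  rw [smul_pow, smul_apply, smul_eq_mul]
  ring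

theorem tendsto_exp_smul_sub_one_div (Q : Matrix ι ι ℝ) (i j : ι) :
    Tendsto (fun t : ℝ => (NormedSpace.exp (t • Q) i j - (1 : Matrix ι ι ℝ) i j) / t) (𝓝[>] 0)
      (𝓝 (Q i j)) := by
  have h : Tendsto (fun t : ℝ => t⁻¹ • (NormedSpace.exp (t • Q) - 1)) (𝓝[>] 0) (𝓝 Q) := by
    open scoped Norms.Operator in
    have h' := (hasDerivAt_exp_smul_const (𝕂 := ℝ) Q (0 : ℝ)).tendsto_slope_zero_right
    simp only [zero_smul, NormedSpace.exp_zero, one_mul, zero_add] at h'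
    exact h'
  have hc : Continuous fun B : Matrix ι ι ℝ => B i j := continuous_id.matrix_elem i j
  refine ((hc.tendsto _).comp h).congr fun t => ?_
  simp only [Function.comp_apply, smul_apply, sub_apply, smul_eq_mul, div_eq_inv_mul]

theorem exists_add_smul_one_nonneg {Q : Matrix ι ι ℝ} (hQ : ∀ i j, i ≠ j → 0 ≤ Q i j) :
    ∃ c : ℝ, ∀ i j, 0 ≤ (Q + c • (1 : Matrix ι ι ℝ)) i j := by
  -- This shift exceeds every single $|Q_{ii}|$, so no case split on an empty index set is needed,
  -- as a maximum would require.
  refine ⟨∑ i, |Q i i|, fun i j => ?_⟩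
  rcases eq_or_ne i j with rfl | hij
  · have := Finset.single_le_sum (f := fun i => |Q i i|) (fun i _ => abs_nonneg _)
      (Finset.mem_univ i)
    have := neg_abs_le (Q i i)
    simp only [add_apply, smul_apply, one_apply_eq, smul_eq_mul, mul_one]
    linarith
  · simpa [hij] using hQ i j hij

/-- An entry of a power is a sum over paths; the paths of `A` are those of `B` that stay in the
range of `e`, and the other paths have nonnegative weight. -/
theorem pow_apply_le_pow_apply {A : Matrix ι ι ℝ} {B : Matrix κ κ ℝ} (e : ι ↪ κ)
    (hB : ∀ i j, 0 ≤ B i j) (hAB : ∀ i j, A i j = B (e i) (e j)) (m : ℕ) (i j : ι) :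
    (A ^ m) i j ≤ (B ^ m) (e i) (e j) := by
  induction m generalizing i j with
  | zero => simp [one_apply]
  | succ m ih =>
    rw [pow_succ, pow_succ, mul_apply, mul_apply]
    calc ∑ x, (A ^ m) i x * A x j ≤ ∑ x, (B ^ m) (e i) (e x) * B (e x) (e j) :=
          Finset.sum_le_sum fun x _ => by
            rw [hAB]; exact mul_le_mul_of_nonneg_right (ih i x) (hB _ _)
      _ = ∑ y ∈ Finset.univ.map e, (B ^ m) (e i) y * B y (e j) := by rw [Finset.sum_map]
      _ ≤ ∑ y, (B ^ m) (e i) y * B y (e j) :=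
          Finset.sum_le_sum_of_subset_of_nonneg (Finset.subset_univ _) fun y _ _ =>
            mul_nonneg (pow_apply_nonneg hB m _ _) (hB _ _)

theorem sum_pow_apply_mul_le {A : Matrix ι ι ℝ} (hA : ∀ i j, 0 ≤ A i j) {w : ι → ℝ} {c : ℝ}
    (hc : 0 ≤ c) (hw : ∀ i, ∑ j, A i j * w j ≤ c * w i) (m : ℕ) (i : ι) :
    ∑ j, (A ^ m) i j * w j ≤ c ^ m * w i := by
  induction m generalizing i with
  | zero => simp [one_apply]
  | succ m ih =>
    calc ∑ j, (A ^ (m + 1)) i j * w j = ∑ x, (A ^ m) i x * ∑ j, A x j * w j := by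
          simp_rw [pow_succ, mul_apply, Finset.sum_mul, Finset.mul_sum]
          rw [Finset.sum_comm]
          simp_rw [mul_assoc]
      _ ≤ ∑ x, (A ^ m) i x * (c * w x) :=
          Finset.sum_le_sum fun x _ => mul_le_mul_of_nonneg_left (hw x) (pow_apply_nonneg hA m i x)
      _ = c * ∑ x, (A ^ m) i x * w x := by
          rw [Finset.mul_sum]; exact Finset.sum_congr rfl fun x _ => by ring
      _ ≤ c * (c ^ m * w i) := mul_le_mul_of_nonneg_left (ih i) hc
      _ = c ^ (m + 1) * w i := by ring

theorem exp_smul_apply_nonneg {Q : Matrix ι ι ℝ} (hQ : ∀ i j, i ≠ j → 0 ≤ Q i j) {t : ℝ}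
    (ht : 0 ≤ t) (i j : ι) : 0 ≤ NormedSpace.exp (t • Q) i j := by
  obtain ⟨c, hc⟩ := exists_add_smul_one_nonneg hQ
  refine (hasSum_exp_smul_apply Q c t i j).nonneg fun m => ?_
  have := pow_apply_nonneg hc m i j
  positivity

theorem exp_smul_apply_le_exp_smul_apply {Q : Matrix ι ι ℝ} {R : Matrix κ κ ℝ} (e : ι ↪ κ)
    (hR : ∀ i j, i ≠ j → 0 ≤ R i j) (hQR : ∀ i j, Q i j = R (e i) (e j)) {t : ℝ}
    (ht : 0 ≤ t) (i j : ι) :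
    NormedSpace.exp (t • Q) i j ≤ NormedSpace.exp (t • R) (e i) (e j) := by
  obtain ⟨c, hc⟩ := exists_add_smul_one_nonneg hR
  refine hasSum_le (fun m => ?_) (hasSum_exp_smul_apply Q c t i j)
    (hasSum_exp_smul_apply R c t (e i) (e j))
  refine mul_le_mul_of_nonneg_left (pow_apply_le_pow_apply e hc (fun i j => ?_) m i j)
    (by positivity)
  simp [hQR, one_apply]

theorem sum_exp_smul_apply_mul_le {Q : Matrix ι ι ℝ} (hQ : ∀ i j, i ≠ j → 0 ≤ Q i j)
    {w : ι → ℝ} (hw : ∀ i, ∑ j, Q i j * w j ≤ 0) {t : ℝ} (ht : 0 ≤ t)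
    (i : ι) : ∑ j, NormedSpace.exp (t • Q) i j * w j ≤ w i := by
  obtain ⟨c₀, hc₀⟩ := exists_add_smul_one_nonneg hQ
  obtain ⟨c, hcpos, hc⟩ : ∃ c : ℝ, 0 ≤ c ∧ ∀ i j, 0 ≤ (Q + c • (1 : Matrix ι ι ℝ)) i j := by
    -- The induction on powers multiplies inequalities by the shift, so it must also be nonnegative.
    refine ⟨max c₀ 0, le_max_right _ _, fun i j => (hc₀ i j).trans ?_⟩
    have h1 : 0 ≤ (1 : Matrix ι ι ℝ) i j := by rw [one_apply]; split_ifs <;> norm_num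
    simpa using mul_le_mul_of_nonneg_right (le_max_left c₀ 0) h1
  have hcw (i : ι) : ∑ j, (Q + c • (1 : Matrix ι ι ℝ)) i j * w j ≤ c * w i := by
    simpa [add_mul, Finset.sum_add_distrib, one_apply] using hw i
  have hL := hasSum_sum fun j (_ : j ∈ Finset.univ) =>
    (hasSum_exp_smul_apply Q c t i j).mul_right (w j)
  -- The numbers $e^{-tc}(tc)^m/m!$ are Poisson weights with sum 1.
  have hR : HasSum (fun m : ℕ => Real.exp (-(t * c)) * ((m.factorial : ℝ)⁻¹ * t ^ m) *
      (c ^ m * w i)) (w i) := by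
    have h := ((NormedSpace.expSeries_div_hasSum_exp (t * c)).mul_left
      (Real.exp (-(t * c)))).mul_right (w i)
    rw [← Real.exp_eq_exp_ℝ, ← Real.exp_add, neg_add_cancel, Real.exp_zero, one_mul] at h
    refine h.congr_fun fun m => ?_
    rw [mul_pow, div_eq_mul_inv]
    ring
  refine hasSum_le (fun m => ?_) hL hR
  simp_rw [mul_assoc (Real.exp (-(t * c)) * _), ← Finset.mul_sum]
  exact mul_le_mul_of_nonneg_left (sum_pow_apply_mul_le hc hcpos hcw m i) (by positivity)

end Matrix

/-! ### The minimal transition function of a Q-matrix -/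

section MinimalTransition

variable {α : Type*}

/-- `w` is nonnegative and its image under every finite truncation of `Q` is nonpositive. -/
def IsSuperharmonic (Q : α → α → ℝ) (w : α → ℝ) : Prop :=
  (∀ i, 0 ≤ w i) ∧ ∀ S : Finset α, ∀ i ∈ S, ∑ j ∈ S, Q i j * w j ≤ 0

theorem restrict_offDiag_nonneg {Q : α → α → ℝ} (hQ : ∀ i j, i ≠ j → 0 ≤ Q i j) (S : Finset α)
    (i j : S) (hij : i ≠ j) : 0 ≤ (Matrix.of fun i j : S => Q i j) i j :=
  hQ i j fun h => hij (Subtype.ext h)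

variable [DecidableEq α]

/-- Transition function of the chain with rates `Q` killed on leaving the finite set `S`. -/
noncomputable def killedTransition (Q : α → α → ℝ) (S : Finset α) (t : ℝ) (k n : α) : ℝ :=
  if h : k ∈ S ∧ n ∈ S then
    NormedSpace.exp (t • (Matrix.of fun i j : S => Q i j)) ⟨k, h.1⟩ ⟨n, h.2⟩
  else 0

/-- Transition function of the chain with rates `Q` killed at explosion. -/
noncomputable def minimalTransition (Q : α → α → ℝ) (t : ℝ) (k n : α) : ℝ :=
  ⨆ S : Finset α, killedTransition Q S t k n

variable {Q : α → α → ℝ}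

theorem killedTransition_of_mem {S : Finset α} {k n : α} (hk : k ∈ S) (hn : n ∈ S) (t : ℝ) :
    killedTransition Q S t k n =
      NormedSpace.exp (t • (Matrix.of fun i j : S => Q i j)) ⟨k, hk⟩ ⟨n, hn⟩ :=
  dif_pos ⟨hk, hn⟩

theorem killedTransition_of_notMem_left {S : Finset α} {k : α} (hk : k ∉ S) (t : ℝ) (n : α) :
    killedTransition Q S t k n = 0 :=
  dif_neg fun h => hk h.1

theorem killedTransition_of_notMem_right {S : Finset α} {n : α} (hn : n ∉ S) (t : ℝ) (k : α) :
    killedTransition Q S t k n = 0 :=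
  dif_neg fun h => hn h.2

theorem killedTransition_zero {S : Finset α} {k : α} (hk : k ∈ S) (n : α) :
    killedTransition Q S 0 k n = if n = k then 1 else 0 := by
  by_cases hn : n ∈ S
  · rw [killedTransition_of_mem hk hn, zero_smul, NormedSpace.exp_zero, Matrix.one_apply]
    simp [eq_comm]
  · rw [killedTransition_of_notMem_right hn, if_neg]
    rintro rfl
    exact hn hk

theorem killedTransition_add (S : Finset α) (s t : ℝ) (k n : α) :
    killedTransition Q S (s + t) k n =
      ∑ j ∈ S, killedTransition Q S s k j * killedTransition Q S t j n := by
  by_cases hk : k ∈ S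
  · by_cases hn : n ∈ S
    · rw [killedTransition_of_mem hk hn, add_smul, Matrix.exp_add_of_commute _ _
        (((Commute.refl _).smul_left _).smul_right _), Matrix.mul_apply, ← Finset.sum_coe_sort S]
      refine Finset.sum_congr rfl fun j _ => ?_
      rw [killedTransition_of_mem hk j.2, killedTransition_of_mem j.2 hn]
    · simp [killedTransition_of_notMem_right hn]
  · simp [killedTransition_of_notMem_left hk]

theorem tendsto_killedTransition_div {S : Finset α} {k n : α} (hk : k ∈ S) (hn : n ∈ S) :
    Tendsto (fun t : ℝ => (killedTransition Q S t k n - if k = n then 1 else 0) / t) (𝓝[>] 0)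
      (𝓝 (Q k n)) := by
  have h := Matrix.tendsto_exp_smul_sub_one_div (Matrix.of fun i j : S => Q i j) ⟨k, hk⟩ ⟨n, hn⟩
  simpa [Matrix.one_apply, killedTransition_of_mem hk hn] using h

theorem killedTransition_nonneg (hQ : ∀ i j, i ≠ j → 0 ≤ Q i j) (S : Finset α) {t : ℝ}
    (ht : 0 ≤ t) (k n : α) : 0 ≤ killedTransition Q S t k n := by
  unfold killedTransition
  split_ifs with h
  · exact Matrix.exp_smul_apply_nonneg (restrict_offDiag_nonneg hQ S) ht _ _
  · exact le_rfl

/-- A larger set kills fewer paths. -/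
theorem killedTransition_mono (hQ : ∀ i j, i ≠ j → 0 ≤ Q i j) {t : ℝ} (ht : 0 ≤ t) (k n : α) :
    Monotone fun S : Finset α => killedTransition Q S t k n := by
  intro S T hST
  by_cases h : k ∈ S ∧ n ∈ S
  · simp only [killedTransition_of_mem h.1 h.2, killedTransition_of_mem (hST h.1) (hST h.2)]
    exact Matrix.exp_smul_apply_le_exp_smul_apply
      (R := Matrix.of fun i j : T => Q i j)
      (Subtype.impEmbedding _ _ hST)
      (restrict_offDiag_nonneg hQ T) (fun i j => rfl) ht ⟨k, h.1⟩ ⟨n, h.2⟩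
  · refine le_trans (le_of_eq (dif_neg h)) (killedTransition_nonneg hQ T ht k n)

theorem sum_killedTransition_mul_le (hQ : ∀ i j, i ≠ j → 0 ≤ Q i j) {w : α → ℝ}
    (hw : IsSuperharmonic Q w) (S F : Finset α) {t : ℝ} (ht : 0 ≤ t) (k : α) :
    ∑ n ∈ F, killedTransition Q S t k n * w n ≤ w k := by
  by_cases hk : k ∈ S
  · calc ∑ n ∈ F, killedTransition Q S t k n * w n
        ≤ ∑ n ∈ F ∪ S, killedTransition Q S t k n * w n :=
          Finset.sum_le_sum_of_subset_of_nonneg Finset.subset_union_left fun n _ _ =>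
            mul_nonneg (killedTransition_nonneg hQ S ht k n) (hw.1 n)
      _ = ∑ n ∈ S, killedTransition Q S t k n * w n := by
          refine (Finset.sum_subset Finset.subset_union_right fun n _ hn => ?_).symm
          rw [killedTransition_of_notMem_right hn, zero_mul]
      _ = ∑ n : S, NormedSpace.exp (t • (Matrix.of fun i j : S => Q i j)) ⟨k, hk⟩ n * w n := by
          rw [← Finset.sum_coe_sort S]
          exact Finset.sum_congr rfl fun n _ => by rw [killedTransition_of_mem hk n.2]
      _ ≤ w k := by
          refine Matrix.sum_exp_smul_apply_mul_le (w := fun n : S => w n)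
            (restrict_offDiag_nonneg hQ S) (fun i => ?_) ht ⟨k, hk⟩
          have := hw.2 S i i.2
          rwa [← Finset.sum_coe_sort S] at this
  · simpa [killedTransition_of_notMem_left hk] using hw.1 k

theorem tendsto_killedTransition (hQ : ∀ i j, i ≠ j → 0 ≤ Q i j)
    (h1 : IsSuperharmonic Q fun _ => 1) {t : ℝ} (ht : 0 ≤ t) (k n : α) :
    Tendsto (fun S : Finset α => killedTransition Q S t k n) atTop
      (𝓝 (minimalTransition Q t k n)) := by
  -- The real supremum is meaningful only for a bounded family; the bound 1 comes from
  -- superharmonicity of the constant 1.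
  refine tendsto_atTop_ciSup (killedTransition_mono hQ ht k n) ⟨1, ?_⟩
  rintro _ ⟨S, rfl⟩
  simpa using sum_killedTransition_mul_le hQ h1 S {n} ht k

theorem killedTransition_le_minimalTransition (hQ : ∀ i j, i ≠ j → 0 ≤ Q i j)
    (h1 : IsSuperharmonic Q fun _ => 1) {t : ℝ} (ht : 0 ≤ t) (S : Finset α) (k n : α) :
    killedTransition Q S t k n ≤ minimalTransition Q t k n :=
  (killedTransition_mono hQ ht k n).ge_of_tendsto (tendsto_killedTransition hQ h1 ht k n) S

theorem minimalTransition_nonneg (hQ : ∀ i j, i ≠ j → 0 ≤ Q i j)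
    (h1 : IsSuperharmonic Q fun _ => 1) {t : ℝ} (ht : 0 ≤ t) (k n : α) :
    0 ≤ minimalTransition Q t k n :=
  (killedTransition_nonneg hQ ∅ ht k n).trans
    (killedTransition_le_minimalTransition hQ h1 ht ∅ k n)

theorem sum_minimalTransition_mul_le (hQ : ∀ i j, i ≠ j → 0 ≤ Q i j)
    (h1 : IsSuperharmonic Q fun _ => 1) {w : α → ℝ} (hw : IsSuperharmonic Q w) (F : Finset α)
    {t : ℝ} (ht : 0 ≤ t) (k : α) : ∑ n ∈ F, minimalTransition Q t k n * w n ≤ w k :=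
  le_of_tendsto' (tendsto_finsetSum F fun n _ =>
    (tendsto_killedTransition hQ h1 ht k n).mul_const (w n))
    fun S => sum_killedTransition_mul_le hQ hw S F ht k

theorem summable_minimalTransition_mul (hQ : ∀ i j, i ≠ j → 0 ≤ Q i j)
    (h1 : IsSuperharmonic Q fun _ => 1) {w : α → ℝ} (hw : IsSuperharmonic Q w)
    {t : ℝ} (ht : 0 ≤ t) (k : α) : Summable fun n => minimalTransition Q t k n * w n :=
  summable_of_sum_le (fun n => mul_nonneg (minimalTransition_nonneg hQ h1 ht k n) (hw.1 n))
    fun F => sum_minimalTransition_mul_le hQ h1 hw F ht k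

theorem tsum_minimalTransition_mul_le (hQ : ∀ i j, i ≠ j → 0 ≤ Q i j)
    (h1 : IsSuperharmonic Q fun _ => 1) {w : α → ℝ} (hw : IsSuperharmonic Q w)
    {t : ℝ} (ht : 0 ≤ t) (k : α) : ∑' n, minimalTransition Q t k n * w n ≤ w k :=
  (summable_minimalTransition_mul hQ h1 hw ht k).tsum_le_of_sum_le
    fun F => sum_minimalTransition_mul_le hQ h1 hw F ht k

theorem minimalTransition_le_one (hQ : ∀ i j, i ≠ j → 0 ≤ Q i j)
    (h1 : IsSuperharmonic Q fun _ => 1) {t : ℝ} (ht : 0 ≤ t) (k n : α) :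
    minimalTransition Q t k n ≤ 1 := by
  simpa using sum_minimalTransition_mul_le hQ h1 h1 {n} ht k

theorem minimalTransition_zero (hQ : ∀ i j, i ≠ j → 0 ≤ Q i j)
    (h1 : IsSuperharmonic Q fun _ => 1) (k n : α) :
    minimalTransition Q 0 k n = if n = k then 1 else 0 := by
  refine tendsto_nhds_unique (tendsto_killedTransition hQ h1 le_rfl k n)
    (tendsto_const_nhds.congr' ?_)
  filter_upwards [eventually_ge_atTop {k}] with S hS
  rw [killedTransition_zero (hS (Finset.mem_singleton_self k))]

/-- Passes the semigroup law of the killed chains to the limit in $S$ by dominated convergence; the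
majorant is the product of the minimal transition functions. -/
theorem hasSum_minimalTransition_add (hQ : ∀ i j, i ≠ j → 0 ≤ Q i j)
    (h1 : IsSuperharmonic Q fun _ => 1) {s t : ℝ} (hs : 0 ≤ s) (ht : 0 ≤ t) (k n : α) :
    HasSum (fun j => minimalTransition Q s k j * minimalTransition Q t j n)
      (minimalTransition Q (s + t) k n) := by
  have hsum : Summable fun j => minimalTransition Q s k j := by
    simpa using summable_minimalTransition_mul hQ h1 h1 hs k
  have hsum' : Summable fun j => minimalTransition Q s k j * minimalTransition Q t j n :=
    hsum.of_nonneg_of_le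
      (fun j => mul_nonneg (minimalTransition_nonneg hQ h1 hs k j)
        (minimalTransition_nonneg hQ h1 ht j n))
      fun j => mul_le_of_le_one_right (minimalTransition_nonneg hQ h1 hs k j)
        (minimalTransition_le_one hQ h1 ht j n)
  have hlim : Tendsto
      (fun S : Finset α => ∑' j, killedTransition Q S s k j * killedTransition Q S t j n) atTop
      (𝓝 (∑' j, minimalTransition Q s k j * minimalTransition Q t j n)) := by
    refine tendsto_tsum_of_dominated_convergence hsum'
      (fun j => (tendsto_killedTransition hQ h1 hs k j).mul
        (tendsto_killedTransition hQ h1 ht j n)) (Eventually.of_forall fun S j => ?_)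
    have h2 := killedTransition_nonneg hQ S hs k j
    have h3 := killedTransition_nonneg hQ S ht j n
    rw [Real.norm_of_nonneg (mul_nonneg h2 h3)]
    exact mul_le_mul (killedTransition_le_minimalTransition hQ h1 hs S k j)
      (killedTransition_le_minimalTransition hQ h1 ht S j n) h3
      (minimalTransition_nonneg hQ h1 hs k j)
  have heq : ∑' j, minimalTransition Q s k j * minimalTransition Q t j n =
      minimalTransition Q (s + t) k n := by
    refine tendsto_nhds_unique hlim
      ((tendsto_killedTransition hQ h1 (add_nonneg hs ht) k n).congr fun S => ?_)
    rw [killedTransition_add, tsum_eq_sum fun j hj => ?_]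
    rw [killedTransition_of_notMem_right hj, zero_mul]
  exact heq ▸ hsum'.hasSum

end MinimalTransition

/-! ### The minimal birth-and-death process -/

/-- The generator of the birth-and-death process with rates `lam`, `mu`. -/
def birthDeathGenerator (lam mu : ℤ → ℝ) (i j : ℤ) : ℝ :=
  if j = i + 1 then lam i else if j = i - 1 then mu i else if j = i then -(lam i + mu i) else 0

section BirthDeath

variable {lam mu : ℤ → ℝ}

theorem birthDeathGenerator_offDiag_nonneg (hlam : ∀ n, 0 < lam n) (hmu : ∀ n, 0 < mu n)
    (i j : ℤ) (hij : i ≠ j) : 0 ≤ birthDeathGenerator lam mu i j := by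
  unfold birthDeathGenerator
  split_ifs with h₁ h₂ h₃
  · exact (hlam i).le
  · exact (hmu i).le
  · exact absurd h₃.symm hij
  · exact le_rfl

/-- Truncating to $S\ni i$ can only drop the neighbour terms, which are nonnegative; the negative
diagonal term stays. -/
theorem isSuperharmonic_birthDeathGenerator (hlam : ∀ n, 0 < lam n) (hmu : ∀ n, 0 < mu n)
    {w : ℤ → ℝ} (hw : ∀ n, 0 ≤ w n)
    (hharm : ∀ n : ℤ, w (n + 1) * lam n - w n * (lam n + mu n) + w (n - 1) * mu n ≤ 0) :
    IsSuperharmonic (birthDeathGenerator lam mu) w := by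
  refine ⟨hw, fun S i hi => ?_⟩
  have hterm (j : ℤ) : birthDeathGenerator lam mu i j * w j =
      (if j = i + 1 then lam i * w (i + 1) else 0) + (if j = i - 1 then mu i * w (i - 1) else 0) +
        (if j = i then -(lam i + mu i) * w i else 0) := by
    unfold birthDeathGenerator
    by_cases h₁ : j = i + 1
    · subst h₁; simp [show i + 1 ≠ i - 1 by omega]
    by_cases h₂ : j = i - 1
    · subst h₂; simp [show i - 1 ≠ i + 1 by omega]
    by_cases h₃ : j = i
    · subst h₃; simp [show j ≠ j + 1 by omega, show j ≠ j - 1 by omega]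
    simp [h₁, h₂, h₃]
  simp_rw [hterm, Finset.sum_add_distrib, Finset.sum_ite_eq', if_pos hi]
  have hb : (if i + 1 ∈ S then lam i * w (i + 1) else 0) ≤ lam i * w (i + 1) := by
    split_ifs
    · exact le_rfl
    · exact mul_nonneg (hlam i).le (hw _)
  have hd : (if i - 1 ∈ S then mu i * w (i - 1) else 0) ≤ mu i * w (i - 1) := by
    split_ifs
    · exact le_rfl
    · exact mul_nonneg (hmu i).le (hw _)
  linarith [hharm i]

theorem isSuperharmonic_birthDeathGenerator_one (hlam : ∀ n, 0 < lam n) (hmu : ∀ n, 0 < mu n) :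
    IsSuperharmonic (birthDeathGenerator lam mu) fun _ => 1 :=
  isSuperharmonic_birthDeathGenerator hlam hmu (fun _ => zero_le_one) fun n => by linarith

/-- Jump rates from lower bounds: if `a`, `b`, `r` add up to at most one and dominate functions
`a₀`, `b₀`, `r₀` whose rates at `0` balance, then they have the same rates. -/
theorem tendsto_rates_of_lower_bounds {a b r a₀ b₀ r₀ : ℝ → ℝ} {A B : ℝ}
    (ha : ∀ t, 0 < t → a₀ t ≤ a t) (hb : ∀ t, 0 < t → b₀ t ≤ b t) (hr : ∀ t, 0 < t → r₀ t ≤ r t)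
    (hsum : ∀ t, 0 < t → a t + b t + r t ≤ 1)
    (ha₀ : Tendsto (fun t => a₀ t / t) (𝓝[>] 0) (𝓝 A))
    (hb₀ : Tendsto (fun t => b₀ t / t) (𝓝[>] 0) (𝓝 B))
    (hr₀ : Tendsto (fun t => (1 - r₀ t) / t) (𝓝[>] 0) (𝓝 (A + B))) :
    Tendsto (fun t => a t / t) (𝓝[>] 0) (𝓝 A) ∧ Tendsto (fun t => b t / t) (𝓝[>] 0) (𝓝 B) ∧
      Tendsto (fun t => (1 - r t) / t) (𝓝[>] 0) (𝓝 (A + B)) := by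
  refine ⟨?_, ?_, ?_⟩
  -- Squeeze: $a_0\le a\le 1-r-b\le 1-r_0-b_0$, and the last rate is $(A+B)-B$.
  · have hup : Tendsto (fun t => (1 - r₀ t) / t - b₀ t / t) (𝓝[>] 0) (𝓝 A) := by
      simpa using hr₀.sub hb₀
    refine tendsto_of_tendsto_of_tendsto_of_le_of_le' ha₀ hup ?_ ?_ <;>
      filter_upwards [self_mem_nhdsWithin] with t (ht : 0 < t)
    · exact div_le_div_of_nonneg_right (ha t ht) ht.le
    · rw [← sub_div]
      exact div_le_div_of_nonneg_right (by linarith [hb t ht, hr t ht, hsum t ht]) ht.le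
  · have hup : Tendsto (fun t => (1 - r₀ t) / t - a₀ t / t) (𝓝[>] 0) (𝓝 B) := by
      simpa using hr₀.sub ha₀
    refine tendsto_of_tendsto_of_tendsto_of_le_of_le' hb₀ hup ?_ ?_ <;>
      filter_upwards [self_mem_nhdsWithin] with t (ht : 0 < t)
    · exact div_le_div_of_nonneg_right (hb t ht) ht.le
    · rw [← sub_div]
      exact div_le_div_of_nonneg_right (by linarith [ha t ht, hr t ht, hsum t ht]) ht.le
  · refine tendsto_of_tendsto_of_tendsto_of_le_of_le' (ha₀.add hb₀) hr₀ ?_ ?_ <;>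
      filter_upwards [self_mem_nhdsWithin] with t (ht : 0 < t)
    · rw [← add_div]
      exact div_le_div_of_nonneg_right (by linarith [ha t ht, hb t ht, hsum t ht]) ht.le
    · exact div_le_div_of_nonneg_right (by linarith [hr t ht]) ht.le

/-- Every jump from $n$ lands in $\{n-1,n,n+1\}$, so the chain killed outside these three states
already has the right rates at $n$. It lies below the minimal one, whose row sums are at most 1, and
this forces equal rates. -/
theorem tendsto_minimalTransition_rates (hlam : ∀ n, 0 < lam n) (hmu : ∀ n, 0 < mu n) (n : ℤ) :
    Tendsto (fun δ : ℝ => minimalTransition (birthDeathGenerator lam mu) δ n (n + 1) / δ)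
        (𝓝[>] 0) (𝓝 (lam n)) ∧
      Tendsto (fun δ : ℝ => minimalTransition (birthDeathGenerator lam mu) δ n (n - 1) / δ)
        (𝓝[>] 0) (𝓝 (mu n)) ∧
      Tendsto (fun δ : ℝ => (1 - minimalTransition (birthDeathGenerator lam mu) δ n n) / δ)
        (𝓝[>] 0) (𝓝 (lam n + mu n)) := by
  have hQ := birthDeathGenerator_offDiag_nonneg hlam hmu
  have h1 := isSuperharmonic_birthDeathGenerator_one hlam hmu
  let S : Finset ℤ := {n + 1, n - 1, n}
  refine tendsto_rates_of_lower_bounds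
    (a₀ := fun t => killedTransition (birthDeathGenerator lam mu) S t n (n + 1))
    (b₀ := fun t => killedTransition (birthDeathGenerator lam mu) S t n (n - 1))
    (r₀ := fun t => killedTransition (birthDeathGenerator lam mu) S t n n)
    (fun t ht => killedTransition_le_minimalTransition hQ h1 ht.le S n _)
    (fun t ht => killedTransition_le_minimalTransition hQ h1 ht.le S n _)
    (fun t ht => killedTransition_le_minimalTransition hQ h1 ht.le S n _) (fun t ht => ?_) ?_ ?_ ?_
  · have h := sum_minimalTransition_mul_le hQ h1 h1 S ht.le n
    rw [Finset.sum_insert (by simp; omega), Finset.sum_insert (by simp),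
      Finset.sum_singleton] at h
    linarith
  · simpa [birthDeathGenerator] using
      tendsto_killedTransition_div (Q := birthDeathGenerator lam mu) (S := S) (k := n)
        (n := n + 1) (by simp [S]) (by simp [S])
  · simpa [birthDeathGenerator, show n - 1 ≠ n + 1 by omega, show n ≠ n - 1 by omega] using
      tendsto_killedTransition_div (Q := birthDeathGenerator lam mu) (S := S) (k := n)
        (n := n - 1) (by simp [S]) (by simp [S])
  · have h := (tendsto_killedTransition_div (Q := birthDeathGenerator lam mu) (S := S) (k := n)
      (n := n) (by simp [S]) (by simp [S])).neg
    have hval : -birthDeathGenerator lam mu n n = lam n + mu n := by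
      simp [birthDeathGenerator, show n ≠ n - 1 by omega, add_comm]
    rw [hval] at h
    refine h.congr fun t => ?_
    rw [if_pos rfl, ← neg_div, neg_sub]

theorem isBirthDeathTransition_minimalTransition (hlam : ∀ n, 0 < lam n) (hmu : ∀ n, 0 < mu n) :
    IsBirthDeathTransition lam mu (minimalTransition (birthDeathGenerator lam mu)) := by
  have hQ := birthDeathGenerator_offDiag_nonneg hlam hmu
  have h1 := isSuperharmonic_birthDeathGenerator_one hlam hmu
  exact
    { nonneg := fun t ht => minimalTransition_nonneg hQ h1 ht
      summable_row := fun t ht k => by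
        simpa using summable_minimalTransition_mul hQ h1 h1 ht k
      row_le_one := fun t ht k => by
        simpa using tsum_minimalTransition_mul_le hQ h1 h1 ht k
      initial := minimalTransition_zero hQ h1
      chapman_kolmogorov := fun s t hs ht => hasSum_minimalTransition_add hQ h1 hs ht
      birth_rate := fun n => (tendsto_minimalTransition_rates hlam hmu n).1
      death_rate := fun n => (tendsto_minimalTransition_rates hlam hmu n).2.1
      exit_rate := fun n => (tendsto_minimalTransition_rates hlam hmu n).2.2 }

/-- The transform of a birth-and-death process by a positive harmonic function `nu` which is
excessive for its transition function. -/
theorem IsBirthDeathTransition.transform {p : ℝ → ℤ → ℤ → ℝ}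
    (hp : IsBirthDeathTransition lam mu p) {nu : ℤ → ℝ} (hnu : ∀ n, 0 < nu n)
    (hharm : ∀ n : ℤ, nu (n + 1) * lam n - nu n * (lam n + mu n) + nu (n - 1) * mu n = 0)
    (hsum : ∀ t : ℝ, 0 ≤ t → ∀ k : ℤ, Summable fun n => p t k n * nu n)
    (hle : ∀ t : ℝ, 0 ≤ t → ∀ k : ℤ, ∑' n, p t k n * nu n ≤ nu k) :
    IsBirthDeathTransition (transformedBirth lam nu) (transformedDeath mu nu)
      (fun t k n => nu n / nu k * p t k n) := by
  have hrow (t : ℝ) (k n : ℤ) : nu n / nu k * p t k n = p t k n * nu n / nu k := by ring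
  refine
    { nonneg := fun t ht k n => mul_nonneg (div_pos (hnu n) (hnu k)).le (hp.nonneg t ht k n)
      summable_row := fun t ht k => ?_
      row_le_one := fun t ht k => ?_
      initial := fun k n => ?_
      chapman_kolmogorov := fun s t hs ht k n => ?_
      birth_rate := fun n => ?_
      death_rate := fun n => ?_
      exit_rate := fun n => ?_ }
  · simp_rw [hrow]
    exact (hsum t ht k).div_const _
  · simp_rw [hrow]
    rw [tsum_div_const]
    exact (div_le_one (hnu k)).2 (hle t ht k)
  · simp only [hp.initial]
    split_ifs with h
    · rw [h, div_self (hnu k).ne', one_mul]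
    · rw [mul_zero]
  · refine ((hp.chapman_kolmogorov s t hs ht k n).mul_left (nu n / nu k)).congr_fun fun j => ?_
    have := (hnu j).ne'
    field_simp
  · refine ((hp.birth_rate n).mul_const (nu (n + 1) / nu n)).congr fun δ => ?_
    ring
  · refine ((hp.death_rate n).mul_const (nu (n - 1) / nu n)).congr fun δ => ?_
    ring
  -- This is the harmonic equation divided by $\nu_n$.
  · have hval : transformedBirth lam nu n + transformedDeath mu nu n = lam n + mu n := by
      have := (hnu n).ne'
      unfold transformedBirth transformedDeath
      field_simp
      linarith [hharm n]
    rw [hval]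
    simpa only [div_self (hnu n).ne', one_mul] using hp.exit_rate n

end BirthDeath

/-! ### The transformed process of a simple process. -/

theorem theorem1 (lam mu : ℤ → ℝ) (hlam : ∀ n, 0 < lam n) (hmu : ∀ n, 0 < mu n)
    (p : ℝ → ℤ → ℤ → ℝ) (hp : IsBirthDeathTransition lam mu p)
    (hsimple : IsSimpleBirthDeath lam mu)
    (nu : ℤ → ℝ) (hnu : ∀ n, 0 < nu n) (hmono : StrictMono nu ∨ StrictAnti nu)
    (hharm : ∀ n : ℤ, nu (n + 1) * lam n - nu n * (lam n + mu n) + nu (n - 1) * mu n = 0) :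
    IsBirthDeathTransition (transformedBirth lam nu) (transformedDeath mu nu)
        (fun t k n => nu n / nu k * p t k n) ∧
      (IsSimpleBirthDeath (transformedBirth lam nu) (transformedDeath mu nu) →
        ∀ p' : ℝ → ℤ → ℤ → ℝ,
          IsBirthDeathTransition (transformedBirth lam nu) (transformedDeath mu nu) p' →
          ∀ t : ℝ, 0 ≤ t → ∀ k n : ℤ, p' t k n = nu n / nu k * p t k n) := by
  have hQ := birthDeathGenerator_offDiag_nonneg hlam hmu
  have h1 := isSuperharmonic_birthDeathGenerator_one hlam hmu
  have hw : IsSuperharmonic (birthDeathGenerator lam mu) nu :=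
    isSuperharmonic_birthDeathGenerator hlam hmu (fun n => (hnu n).le) fun n => (hharm n).le
  -- Simplicity identifies `p` with the minimal process, for which superharmonic functions are
  -- excessive.
  have hpq := hsimple p _ hp (isBirthDeathTransition_minimalTransition hlam hmu)
  have htransform := hp.transform hnu hharm
    (fun t ht k => by
      simp_rw [hpq t ht]; exact summable_minimalTransition_mul hQ h1 hw ht k)
    (fun t ht k => by
      simp_rw [hpq t ht]; exact tsum_minimalTransition_mul_le hQ h1 hw ht k)
  exact ⟨htransform, fun hs p' hp' => hs p' _ hp' htransform⟩
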